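/- For real numbers $a,b>0$ and $r\in\mathbb R$, let $$C_r(a,b)=\Big(\frac{b^r+a^r}{b+a}\Big)^{\frac1{r-1}}\quad (r\neq 1),\qquad C_1(a,b)=\lim_{r\to1}C_r(a,b)=\big(b^b a^a\big)^{\frac1{b+a}}.$$ Theorem (Lou's Conjecture 2). For every $r\in[0,+\infty)$ and all $b>a>0$, $$C_r(a,b)^2+C_{-r}(a,b)^2<a^2+b^2.$$ -/

import Mathlib

/-- The generalized inverse harmonic mean `C_r(a,b) = ((b^r + a^r)/(b + a))^(1/(r-1))` of two
positive reals, for finite real `r`; at the removable singularity `r = 1` the value is the limit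
`(b^b a^a)^(1/(b+a))` (see `tendsto_genInvHarmonicMean_one`). -/
noncomputable def genInvHarmonicMean (r a b : ℝ) : ℝ :=
  if r = 1 then (b ^ b * a ^ a) ^ (1 / (b + a))
  else ((b ^ r + a ^ r) / (b + a)) ^ (1 / (r - 1))

/-- The value at `r = 1` is the limit of the values at `r ≠ 1`. -/
theorem tendsto_genInvHarmonicMean_one {a b : ℝ} (ha : 0 < a) (hb : 0 < b) :
    Filter.Tendsto (fun r => genInvHarmonicMean r a b) (nhdsWithin 1 {1}ᶜ)
      (nhds (genInvHarmonicMean 1 a b)) := by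
  have hab : 0 < b + a := add_pos hb ha
  set f : ℝ → ℝ := fun r => Real.log ((b ^ r + a ^ r) / (b + a)) with hf
  have hd : HasDerivAt f ((b * Real.log b + a * Real.log a) / (b + a)) 1 := by
    have h1 : HasDerivAt (fun r : ℝ => b ^ r) (b * Real.log b) 1 := by
      simpa using (Real.hasStrictDerivAt_const_rpow hb 1).hasDerivAt
    have h2 : HasDerivAt (fun r : ℝ => a ^ r) (a * Real.log a) 1 := by
      simpa using (Real.hasStrictDerivAt_const_rpow ha 1).hasDerivAt
    have h3 := ((h1.add h2).div_const (b + a)).log (by simp [hab.ne'])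
    simpa [hab.ne'] using h3
  have h1 : f 1 = 0 := by simp [hf, hab.ne']
  have hs := hasDerivAt_iff_tendsto_slope.1 hd
  have hval : genInvHarmonicMean 1 a b
      = Real.exp ((b * Real.log b + a * Real.log a) / (b + a)) := by
    have hpos : 0 < b ^ b * a ^ a := mul_pos (Real.rpow_pos_of_pos hb _) (Real.rpow_pos_of_pos ha _)
    rw [genInvHarmonicMean, if_pos rfl, Real.rpow_def_of_pos hpos,
      Real.log_mul (Real.rpow_pos_of_pos hb _).ne' (Real.rpow_pos_of_pos ha _).ne',
      Real.log_rpow hb, Real.log_rpow ha, mul_one_div]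
  rw [hval]
  refine ((Real.continuous_exp.tendsto _).comp hs).congr' ?_
  filter_upwards [self_mem_nhdsWithin] with r hr
  have hr1 : r ≠ 1 := hr
  have hpos : 0 < (b ^ r + a ^ r) / (b + a) :=
    div_pos (add_pos (Real.rpow_pos_of_pos hb _) (Real.rpow_pos_of_pos ha _)) hab
  rw [genInvHarmonicMean, if_neg hr1, Real.rpow_def_of_pos hpos, Function.comp_apply,
    slope_def_field, h1, sub_zero, mul_one_div]

/-!
Write `a = exp (m - x)` and `b = exp (m + x)` with `x > 0`. Up to the common factor `exp (2 * m)`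
the squares of the means of parameters `r` and `-r` are `exp (x * w * (x + y))` and
`exp (x * w * (x - y))`, where `y = r * x` and `w` is the divided difference of
`s ↦ 2 * log (2 * cosh √s)` between `x ^ 2` and `y ^ 2`; the sum is to be compared with
`2 * cosh (2 * x)`.

For `x ≤ log 2` the logarithms of both sides are compared: the function above is concave in `s`, and
`w` is controlled by `w * (log (2 * cosh x) + log (2 * cosh y)) < 2`. For `x ≥ log 2` the two
exponentials are bounded separately, by chords of the exponential function, in terms of
`exp (-2 * x)` and `exp (-2 * y)`.
-/

open Real Set

theorem tanh_eq_div_one_add_exp (x : ℝ) :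
    tanh x = (1 - exp (-(2 * x))) / (1 + exp (-(2 * x))) := by
  have h : exp (-x) = exp x * exp (-(2 * x)) := by
    rw [← exp_add]
    ring_nf
  rw [tanh_eq, h]
  field_simp

theorem tanh_pos {x : ℝ} (hx : 0 < x) : 0 < tanh x := by
  rw [tanh_eq_sinh_div_cosh]
  exact div_pos (sinh_pos_iff.2 hx) (cosh_pos x)

theorem hasDerivAt_tanh (x : ℝ) : HasDerivAt tanh (1 / cosh x ^ 2) x := by
  have h := (hasDerivAt_sinh x).div (hasDerivAt_cosh x) (cosh_pos x).ne'
  rw [show cosh x * cosh x - sinh x * sinh x = 1 by linarith [cosh_sq_sub_sinh_sq x]] at h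
  exact h.congr_of_eventuallyEq (.of_forall tanh_eq_sinh_div_cosh)

theorem antitoneOn_tanh_div_self : AntitoneOn (fun x => tanh x / x) (Ioi 0) := by
  have hd : ∀ x ∈ Ioi (0 : ℝ), HasDerivAt (fun x => tanh x / x)
      ((x - sinh x * cosh x) / (x * cosh x) ^ 2) x := fun x hx => by
    have hx0 : x ≠ 0 := (mem_Ioi.1 hx).ne'
    refine ((hasDerivAt_tanh x).div (hasDerivAt_id x) hx0).congr_deriv ?_
    have := (cosh_pos x).ne'
    simp only [id, tanh_eq_sinh_div_cosh]
    field_simp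
  refine antitoneOn_of_hasDerivWithinAt_nonpos (convex_Ioi 0)
    (fun x hx => (hd x hx).continuousAt.continuousWithinAt)
    (fun x hx => (hd x (interior_subset hx)).hasDerivWithinAt) fun x hx => ?_
  have hx0 : 0 ≤ x := (mem_Ioi.1 (interior_subset hx)).le
  have h : x ≤ sinh x * cosh x := (self_le_sinh_iff.2 hx0).trans
    (le_mul_of_one_le_right (sinh_nonneg_iff.2 hx0) (one_le_cosh x))
  exact div_nonpos_of_nonpos_of_nonneg (sub_nonpos.2 h) (sq_nonneg _)

theorem exp_mul_le_one_add {s : ℝ} (hs : 0 ≤ s) (hs1 : s ≤ 1) (v : ℝ) :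
    exp (s * v) ≤ 1 + s * (exp v - 1) := by
  have := convexOn_exp.2 (mem_univ 0) (mem_univ v) (sub_nonneg.2 hs1) hs (by ring)
  simp only [smul_eq_mul, mul_zero, zero_add, exp_zero] at this
  linarith

theorem exp_mul_le_sq {s : ℝ} (hs : 0 ≤ s) (hs1 : s ≤ 1) (v : ℝ) :
    exp (s * v) ≤ (1 + s * (exp (v / 2) - 1)) ^ 2 := by
  have h : exp (s * v) = exp (s * (v / 2)) ^ 2 := by
    rw [← exp_nat_mul]
    ring_nf
  rw [h]
  exact pow_le_pow_left₀ (exp_pos _).le (exp_mul_le_one_add hs hs1 _) 2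

theorem monotoneOn_exp_add_exp_neg_mul {k : ℝ} (hk : 0 ≤ k) (hk1 : k ≤ 1) :
    MonotoneOn (fun t => exp t + exp (-(k * t))) (Ici 0) := by
  have hd (t : ℝ) : HasDerivAt (fun t => exp t + exp (-(k * t)))
      (exp t - k * exp (-(k * t))) t := by
    refine ((Real.hasDerivAt_exp t).add ((hasDerivAt_id t).const_mul k).neg.exp).congr_deriv ?_
    simp only [id, Pi.neg_apply]
    ring
  refine monotoneOn_of_hasDerivWithinAt_nonneg (convex_Ici 0)
    (fun t _ => (hd t).continuousAt.continuousWithinAt)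
    (fun t _ => (hd t).hasDerivWithinAt) fun t ht => ?_
  have ht0 : 0 ≤ t := interior_subset ht
  have h : k * exp (-(k * t)) ≤ 1 :=
    mul_le_one₀ hk1 (exp_pos _).le (exp_le_one_iff.2 (by nlinarith))
  linarith [one_le_exp ht0]

/-- The function `log (2 cosh x) = log (e ^ x + e ^ (-x))`, an antiderivative of `tanh`. -/
noncomputable def logTwoCosh (x : ℝ) : ℝ := log (2 * cosh x)

theorem exp_logTwoCosh (x : ℝ) : exp (logTwoCosh x) = exp x + exp (-x) := by
  rw [logTwoCosh, exp_log (mul_pos two_pos (cosh_pos x)), cosh_eq]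
  ring

@[simp] theorem logTwoCosh_zero : logTwoCosh 0 = log 2 := by simp [logTwoCosh]

@[simp] theorem logTwoCosh_abs (x : ℝ) : logTwoCosh |x| = logTwoCosh x := by simp [logTwoCosh]

theorem hasDerivAt_logTwoCosh (x : ℝ) : HasDerivAt logTwoCosh (tanh x) x := by
  have hc := (cosh_pos x).ne'
  refine (((hasDerivAt_cosh x).const_mul 2).log (by positivity)).congr_deriv ?_
  rw [tanh_eq_sinh_div_cosh]
  field_simp

theorem continuous_logTwoCosh : Continuous logTwoCosh :=
  continuous_iff_continuousAt.2 fun x => (hasDerivAt_logTwoCosh x).continuousAt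

theorem exp_logTwoCosh_sub_self (x : ℝ) : exp (logTwoCosh x - x) = 1 + exp (-(2 * x)) := by
  rw [exp_sub, exp_logTwoCosh, add_div, div_self (exp_pos x).ne', ← exp_sub]
  ring_nf

theorem lt_logTwoCosh (x : ℝ) : x < logTwoCosh x := by
  rw [← exp_lt_exp, exp_logTwoCosh]
  linarith [exp_pos (-x)]

theorem logTwoCosh_le (x : ℝ) : logTwoCosh x ≤ x + exp (-(2 * x)) := by
  linarith [add_one_le_exp (logTwoCosh x - x), exp_logTwoCosh_sub_self x]

theorem tanh_mul_logTwoCosh_lt {x : ℝ} (hx : 0 < x) : tanh x * logTwoCosh x < x := by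
  have hε := exp_pos (-(2 * x))
  have h1 : 1 - exp (-(2 * x)) < 2 * x := by
    linarith [add_one_lt_exp (x := -(2 * x)) (by linarith)]
  have h2 : 0 ≤ 1 - exp (-(2 * x)) := sub_nonneg.2 (exp_le_one_iff.2 (by linarith))
  rw [tanh_eq_div_one_add_exp, div_mul_eq_mul_div, div_lt_iff₀ (by positivity)]
  nlinarith [mul_le_mul_of_nonneg_left (logTwoCosh_le x) h2]

theorem strictMonoOn_sq_sub_logTwoCosh_sq :
    StrictMonoOn (fun x => x ^ 2 - logTwoCosh x ^ 2) (Ici 0) := by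
  have hd (x : ℝ) : HasDerivAt (fun x => x ^ 2 - logTwoCosh x ^ 2)
      (2 * (x - tanh x * logTwoCosh x)) x := by
    refine ((hasDerivAt_pow 2 x).sub ((hasDerivAt_logTwoCosh x).pow 2)).congr_deriv ?_
    push_cast
    ring
  refine strictMonoOn_of_hasDerivWithinAt_pos (convex_Ici 0)
    (fun x _ => (hd x).continuousAt.continuousWithinAt)
    (fun x _ => (hd x).hasDerivWithinAt) fun x hx => ?_
  rw [interior_Ici] at hx
  exact mul_pos two_pos (sub_pos.2 (tanh_mul_logTwoCosh_lt hx))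

theorem exists_sq_sub_sq_mul_tanh_div_eq {x y : ℝ} (hy : 0 ≤ y) (hyx : y < x) :
    ∃ ξ ∈ Ioo y x, (x ^ 2 - y ^ 2) * (tanh ξ / ξ) = 2 * (logTwoCosh x - logTwoCosh y) := by
  obtain ⟨ξ, hξ, h⟩ := exists_ratio_hasDerivAt_eq_ratio_slope logTwoCosh tanh hyx
    continuous_logTwoCosh.continuousOn (fun z _ => hasDerivAt_logTwoCosh z)
    (fun z => z ^ 2) (fun z => 2 * z) (by fun_prop)
    (fun z _ => by simpa using hasDerivAt_pow 2 z)
  have hξ0 : ξ ≠ 0 := (hy.trans_lt hξ.1).ne'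
  refine ⟨ξ, hξ, ?_⟩
  field_simp
  linear_combination h

theorem sq_sub_sq_mul_tanh_div_le {x y : ℝ} (hy : 0 ≤ y) (hyx : y ≤ x) :
    (x ^ 2 - y ^ 2) * (tanh x / x) ≤ 2 * (logTwoCosh x - logTwoCosh y) := by
  rcases hyx.eq_or_lt with rfl | hlt
  · simp
  obtain ⟨ξ, ⟨hyξ, hξx⟩, h⟩ := exists_sq_sub_sq_mul_tanh_div_eq hy hlt
  have hξ : 0 < ξ := hy.trans_lt hyξ
  rw [← h]
  exact mul_le_mul_of_nonneg_left
    (antitoneOn_tanh_div_self hξ (hξ.trans hξx) hξx.le) (sub_nonneg.2 (by gcongr))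

/-- The divided difference of `s ↦ 2 * logTwoCosh (√s)` between `x ^ 2` and `y ^ 2`, with the value
of the derivative on the diagonal. Both means of parameters `r` and `-r` are functions of it, at
`y = r * x`. It is meant for nonnegative arguments: for `y = -x ≠ 0` the quotient is `0 / 0`. -/
noncomputable def sqSlope (x y : ℝ) : ℝ :=
  if y = x then tanh x / x else 2 * (logTwoCosh y - logTwoCosh x) / (y ^ 2 - x ^ 2)

theorem sqSlope_self (x : ℝ) : sqSlope x x = tanh x / x := if_pos rfl

theorem sqSlope_comm (x y : ℝ) : sqSlope x y = sqSlope y x := by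
  rcases eq_or_ne y x with rfl | h
  · rfl
  · rw [sqSlope, sqSlope, if_neg h, if_neg h.symm, ← neg_div_neg_eq]
    ring_nf

theorem sq_sub_sq_mul_sqSlope {x y : ℝ} (hx : 0 ≤ x) (hy : 0 ≤ y) :
    (y ^ 2 - x ^ 2) * sqSlope x y = 2 * (logTwoCosh y - logTwoCosh x) := by
  rcases eq_or_ne y x with rfl | h
  · simp
  · have : y ^ 2 - x ^ 2 ≠ 0 := sub_ne_zero.2 (mt (pow_left_inj₀ hy hx two_ne_zero).1 h)
    rw [sqSlope, if_neg h, mul_div_cancel₀ _ this]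

theorem exists_sqSlope_eq {x y : ℝ} (hx : 0 < x) (hy : 0 ≤ y) :
    ∃ ξ, 0 < ξ ∧ min x y ≤ ξ ∧ sqSlope x y = tanh ξ / ξ := by
  have of_lt {u v : ℝ} (hv : 0 ≤ v) (hvu : v < u) :
      ∃ ξ, 0 < ξ ∧ v ≤ ξ ∧ sqSlope u v = tanh ξ / ξ := by
    obtain ⟨ξ, hξ, h⟩ := exists_sq_sub_sq_mul_tanh_div_eq hv hvu
    have huv : u ^ 2 - v ^ 2 ≠ 0 := (sub_pos.2 (by gcongr)).ne'
    refine ⟨ξ, hv.trans_lt hξ.1, hξ.1.le, mul_left_cancel₀ huv ?_⟩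
    linarith [sq_sub_sq_mul_sqSlope (hv.trans hvu.le) hv]
  rcases lt_trichotomy y x with h | rfl | h
  · rw [min_eq_right h.le]
    exact of_lt hy h
  · exact ⟨y, hx, min_le_left _ _, sqSlope_self y⟩
  · rw [min_eq_left h.le, sqSlope_comm]
    exact of_lt hx.le h

theorem sqSlope_pos {x y : ℝ} (hx : 0 < x) (hy : 0 ≤ y) : 0 < sqSlope x y := by
  obtain ⟨ξ, hξ, -, h⟩ := exists_sqSlope_eq hx hy
  rw [h]
  exact div_pos (tanh_pos hξ) hξ

theorem sq_mul_sqSlope_le {x y : ℝ} (hx : 0 < x) (hy : 0 ≤ y) :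
    x ^ 2 * sqSlope x y ≤ 2 * (logTwoCosh x - log 2) := by
  -- `z ^ 2 * sqSlope x y - 2 * logTwoCosh z` takes the same value at `z = x` and at `z = y`,
  -- so it suffices to bound it at the smaller of the two points.
  have hmin : min x y ^ 2 * sqSlope x y ≤ 2 * (logTwoCosh (min x y) - log 2) := by
    rcases (le_min hx.le hy).eq_or_lt with h0 | h0
    · simp [← h0]
    obtain ⟨ξ, hξ, hle, h⟩ := exists_sqSlope_eq hx hy
    calc min x y ^ 2 * sqSlope x y ≤ min x y ^ 2 * (tanh (min x y) / min x y) := by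
          rw [h]
          exact mul_le_mul_of_nonneg_left (antitoneOn_tanh_div_self h0 hξ hle) (sq_nonneg _)
      _ ≤ 2 * (logTwoCosh (min x y) - log 2) := by
          simpa using sq_sub_sq_mul_tanh_div_le le_rfl h0.le
  rcases min_cases x y with ⟨h, -⟩ | ⟨h, -⟩ <;> rw [h] at hmin
  · exact hmin
  · linarith [sq_sub_sq_mul_sqSlope hx.le hy]

theorem sqSlope_mul_add_lt_two {x y : ℝ} (hx : 0 < x) (hy : 0 ≤ y) :
    sqSlope x y * (logTwoCosh x + logTwoCosh y) < 2 := by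
  have hE := sq_sub_sq_mul_sqSlope hx.le hy
  have hprod : (y ^ 2 - x ^ 2) * (2 - sqSlope x y * (logTwoCosh x + logTwoCosh y)) =
      2 * ((y ^ 2 - logTwoCosh y ^ 2) - (x ^ 2 - logTwoCosh x ^ 2)) := by
    linear_combination -(logTwoCosh x + logTwoCosh y) * hE
  rcases lt_trichotomy y x with h | rfl | h
  · have hφ := strictMonoOn_sq_sub_logTwoCosh_sq hy hx.le h
    have hsq : y ^ 2 < x ^ 2 := by gcongr
    nlinarith
  · rw [sqSlope_self, div_mul_eq_mul_div, div_lt_iff₀ hx]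
    linarith [tanh_mul_logTwoCosh_lt hx]
  · have hφ := strictMonoOn_sq_sub_logTwoCosh_sq hx.le hy h
    have hsq : x ^ 2 < y ^ 2 := by gcongr
    nlinarith

theorem mul_sqSlope_lt_two {x y : ℝ} (hx : 0 < x) (hy : 0 ≤ y) : y * sqSlope x y < 2 := by
  have h := sqSlope_mul_add_lt_two hx hy
  nlinarith [sqSlope_pos hx hy, lt_logTwoCosh x, lt_logTwoCosh y]

theorem antitoneOn_logTwoCosh_div_two_sub :
    AntitoneOn (fun x => logTwoCosh x / 2 - x / tanh (2 * x)) (Ioi 0) := by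
  have hd : ∀ x ∈ Ioi (0 : ℝ), HasDerivAt (fun x => logTwoCosh x / 2 - x / tanh (2 * x))
      ((x - sinh x * cosh x ^ 3) / (2 * (sinh x * cosh x) ^ 2)) x := fun x hx => by
    have hs : sinh x ≠ 0 := (sinh_pos_iff.2 hx).ne'
    have hc : cosh x ≠ 0 := (cosh_pos x).ne'
    have ht : tanh (2 * x) ≠ 0 := (tanh_pos (mul_pos two_pos hx)).ne'
    have h2 : HasDerivAt (fun x => tanh (2 * x)) (1 / cosh (2 * x) ^ 2 * 2) x := by
      exact (hasDerivAt_tanh (2 * x)).comp x (by simpa using (hasDerivAt_id x).const_mul 2)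
    refine (((hasDerivAt_logTwoCosh x).div_const 2).sub
      ((hasDerivAt_id x).div h2 ht)).congr_deriv ?_
    have hC := (cosh_pos (2 * x)).ne'
    simp only [id, tanh_eq_sinh_div_cosh, sinh_two_mul]
    field_simp
    rw [cosh_two_mul]
    ring
  refine antitoneOn_of_hasDerivWithinAt_nonpos (convex_Ioi 0)
    (fun x hx => (hd x hx).continuousAt.continuousWithinAt)
    (fun x hx => (hd x (interior_subset hx)).hasDerivWithinAt) fun x hx => ?_
  have hx0 : 0 ≤ x := (mem_Ioi.1 (interior_subset hx)).le
  have h : x ≤ sinh x * cosh x ^ 3 := (self_le_sinh_iff.2 hx0).trans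
    (le_mul_of_one_le_right (sinh_nonneg_iff.2 hx0) (one_le_pow₀ (one_le_cosh x)))
  exact div_nonpos_of_nonpos_of_nonneg (sub_nonpos.2 h) (by positivity)

theorem four_mul_log_two_le : 4 * log 2 ≤ 15 * log (5 / 4) := by
  rw [← log_rpow two_pos, ← log_rpow (by norm_num)]
  exact log_le_log (by positivity) (by norm_num)

theorem le_tanh_two_mul_mul_add_log_two {x : ℝ} (hx : 0 < x) (hx2 : x ≤ log 2) :
    x ≤ tanh (2 * x) * ((logTwoCosh x + log 2) / 2) := by
  have he : exp (2 * log 2) = 4 := by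
    rw [mul_comm, exp_mul, exp_log two_pos]
    norm_num
  have htanh : tanh (2 * log 2) = 15 / 17 := by
    rw [tanh_eq, exp_neg, he]
    norm_num
  have hM : logTwoCosh (log 2) = log (5 / 4) + log 2 := by
    rw [logTwoCosh, cosh_log two_pos, ← log_mul (by norm_num) two_ne_zero]
    norm_num
  have hanti := antitoneOn_logTwoCosh_div_two_sub hx (log_pos one_lt_two) hx2
  simp only [htanh, hM] at hanti
  rw [mul_comm, ← div_le_iff₀ (tanh_pos (by positivity))]
  linarith [four_mul_log_two_le]

theorem exp_mul_sqSlope_add_exp (x y : ℝ) :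
    exp (x * sqSlope x y * (x + y)) + exp (x * sqSlope x y * (x - y)) =
      exp (x ^ 2 * sqSlope x y + logTwoCosh (y * (x * sqSlope x y))) := by
  rw [exp_add (x ^ 2 * _), exp_logTwoCosh, mul_add (exp _), ← exp_add, ← exp_add]
  ring_nf

theorem sq_mul_sqSlope_add_logTwoCosh_lt {x y : ℝ} (hx : 0 < x) (hx2 : x ≤ log 2)
    (hy : 0 ≤ y) :
    x ^ 2 * sqSlope x y + logTwoCosh (y * (x * sqSlope x y)) < logTwoCosh (2 * x) := by
  have hT0 : 0 < tanh (2 * x) := tanh_pos (by positivity)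
  have hT := le_tanh_two_mul_mul_add_log_two hx hx2
  have hw : 0 < sqSlope x y := sqSlope_pos hx hy
  have hE := sq_sub_sq_mul_sqSlope hx.le hy
  have hsum := sqSlope_mul_add_lt_two hx hy
  have hxw := sq_mul_sqSlope_le hx hy
  have hyw := mul_sqSlope_lt_two hx hy
  set w := sqSlope x y
  set T := tanh (2 * x)
  have hconc := sq_sub_sq_mul_tanh_div_le (x := 2 * x) (y := y * (x * w)) (by positivity)
    (by nlinarith)
  have hrest : w * (logTwoCosh x - x ^ 2 * w / 4) < 1 - y ^ 2 * w ^ 2 / 4 := by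
    linear_combination hsum / 2 + w * hE / 4
  have hlow : (logTwoCosh x + log 2) / 2 ≤ logTwoCosh x - x ^ 2 * w / 4 := by linarith
  have hmain : x * w < (1 - y ^ 2 * w ^ 2 / 4) * T := calc
    x * w ≤ T * ((logTwoCosh x + log 2) / 2) * w := by gcongr
    _ ≤ T * (w * (logTwoCosh x - x ^ 2 * w / 4)) := by
      rw [mul_assoc, mul_comm _ w]
      gcongr
    _ < (1 - y ^ 2 * w ^ 2 / 4) * T := by
      rw [mul_comm]
      gcongr
  have heq : ((2 * x) ^ 2 - (y * (x * w)) ^ 2) * (T / (2 * x)) =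
      2 * x * ((1 - y ^ 2 * w ^ 2 / 4) * T) := by
    field_simp
    ring
  nlinarith

theorem exp_mul_sqSlope_add_exp_lt_of_le_log_two {x y : ℝ} (hx : 0 < x)
    (hx2 : x ≤ log 2) (hy : 0 ≤ y) :
    exp (x * sqSlope x y * (x + y)) + exp (x * sqSlope x y * (x - y)) <
      exp (2 * x) + exp (-(2 * x)) := by
  rw [exp_mul_sqSlope_add_exp, ← exp_logTwoCosh, exp_lt_exp]
  exact sq_mul_sqSlope_add_logTwoCosh_lt hx hx2 hy

theorem exp_neg_two_mul_le_of_log_two_le {x : ℝ} (hx : log 2 ≤ x) : exp (-(2 * x)) ≤ 1 / 4 := calc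
  exp (-(2 * x)) ≤ exp (-(2 * log 2)) := by gcongr
  _ = 1 / 4 := by
    rw [exp_neg, mul_comm, exp_mul, exp_log two_pos]
    norm_num

theorem exp_neg_two_mul_le_one_sub_tanh {x : ℝ} (hx : 0 ≤ x) : exp (-(2 * x)) ≤ 1 - tanh x := by
  have hε := exp_pos (-(2 * x))
  have hε1 : exp (-(2 * x)) ≤ 1 := exp_le_one_iff.2 (by linarith)
  rw [tanh_eq_div_one_add_exp, one_sub_div (by positivity), le_div_iff₀ (by positivity)]
  nlinarith

theorem antitoneOn_add_mul_logTwoCosh_sub_self {x : ℝ} (hx : 1 / 2 ≤ x) :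
    AntitoneOn (fun z => (x + z) * (logTwoCosh z - z)) (Ici x) := by
  have hd (z : ℝ) : HasDerivAt (fun z => (x + z) * (logTwoCosh z - z))
      ((logTwoCosh z - z) - (x + z) * (1 - tanh z)) z := by
    refine (((hasDerivAt_id z).const_add x).mul
      ((hasDerivAt_logTwoCosh z).sub (hasDerivAt_id z))).congr_deriv ?_
    simp only [id, Pi.sub_apply]
    ring
  refine antitoneOn_of_hasDerivWithinAt_nonpos (convex_Ici x)
    (fun z _ => (hd z).continuousAt.continuousWithinAt)
    (fun z _ => (hd z).hasDerivWithinAt) fun z hz => ?_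
  have hxz : x ≤ z := interior_subset hz
  have ht := exp_neg_two_mul_le_one_sub_tanh (x := z) (by linarith)
  nlinarith [logTwoCosh_le z, exp_pos (-(2 * z))]

theorem mul_sqSlope_mul_add_le {x y : ℝ} (hx : 1 / 2 ≤ x) (hxy : x ≤ y) :
    x * sqSlope x y * (x + y) ≤ 2 * x - 2 * x / (x + y) * (logTwoCosh x - x) := by
  have hx0 : 0 < x := by linarith
  rcases hxy.eq_or_lt with rfl | hlt
  · have ht := exp_neg_two_mul_le_one_sub_tanh hx0.le
    have hκ : 2 * x / (x + x) = 1 := by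
      field_simp
      ring
    have hl : x * sqSlope x x * (x + x) = 2 * x * tanh x := by
      rw [sqSlope_self]
      field_simp
      ring
    rw [hκ, hl]
    nlinarith [logTwoCosh_le x, exp_pos (-(2 * x))]
  · have hyx : 0 < y - x := sub_pos.2 hlt
    have hxy0 : 0 < x + y := by linarith
    have hanti : (x + y) * (logTwoCosh y - y) ≤ (x + x) * (logTwoCosh x - x) :=
      antitoneOn_add_mul_logTwoCosh_sub_self hx self_mem_Ici hxy hxy
    have hE := sq_sub_sq_mul_sqSlope hx0.le (hx0.le.trans hxy)
    have hl : x * sqSlope x y * (x + y) = 2 * x * (logTwoCosh y - logTwoCosh x) / (y - x) := by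
      rw [eq_div_iff hyx.ne']
      linear_combination x * hE
    have hr : 2 * x - 2 * x / (x + y) * (logTwoCosh x - x) =
        2 * x * ((x + y) - (logTwoCosh x - x)) / (x + y) := by
      field_simp
    rw [hl, hr, div_le_div_iff₀ hyx hxy0, mul_assoc (2 * x), mul_assoc (2 * x)]
    refine mul_le_mul_of_nonneg_left ?_ (by positivity)
    linear_combination hanti

theorem exp_sub_mul_le {k : ℝ} (hk : 0 ≤ k) (hk1 : k ≤ 1) (x : ℝ) :
    exp (2 * x - k * (logTwoCosh x - x)) ≤ exp (2 * x) - k / (1 + exp (-(2 * x))) := by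
  have hA : exp (2 * x) * exp (-(2 * x)) = 1 := by rw [← exp_add, add_neg_cancel, exp_zero]
  calc exp (2 * x - k * (logTwoCosh x - x))
      = exp (2 * x) * exp (k * -(logTwoCosh x - x)) := by
        rw [← exp_add]
        ring_nf
    _ ≤ exp (2 * x) * (1 + k * (exp (-(logTwoCosh x - x)) - 1)) := by
        gcongr
        exact exp_mul_le_one_add hk hk1 _
    _ = exp (2 * x) - k / (1 + exp (-(2 * x))) := by
        rw [exp_neg (logTwoCosh x - x), exp_logTwoCosh_sub_self]
        field_simp
        linear_combination -k * hA

theorem exp_neg_one_sub_mul_le {x k : ℝ} (hx : log 2 ≤ x) (hk : 0 ≤ k) (hk1 : k ≤ 1) :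
    exp (-((1 - k) * (2 * x - k * (logTwoCosh x - x)))) ≤ k + (1 - k) * exp (-(2 * x)) := by
  have hl := exp_logTwoCosh_sub_self x
  have hε := exp_neg_two_mul_le_of_log_two_le hx
  have hε0 := exp_pos (-(2 * x))
  have hk' : 0 ≤ 1 - k := sub_nonneg.2 hk1
  set l := logTwoCosh x - x
  set ε := exp (-(2 * x))
  set q := exp (-(2 * x - k * l) / 2) with hq
  have hq0 : 0 < q := exp_pos _
  have hq2 : q ^ 2 ≤ ε * (1 + k * ε) := calc
    q ^ 2 = ε * exp (k * l) := by
      rw [hq, ← exp_nat_mul, ← exp_add]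
      ring_nf
    _ ≤ ε * (1 + k * (exp l - 1)) := by
      gcongr
      exact exp_mul_le_one_add hk hk1 _
    _ = ε * (1 + k * ε) := by rw [hl, add_sub_cancel_left]
  have hkε : k * ε ≤ ε := mul_le_of_le_one_left hε0.le hk1
  have hq1 : ε ≤ 1 - q := by nlinarith
  -- The square of the chord of `exp (v / 2)` is needed: the chord of `exp v` is too weak a bound.
  calc exp (-((1 - k) * (2 * x - k * l)))
      = exp ((1 - k) * -(2 * x - k * l)) := by rw [mul_neg]
    _ ≤ (1 + (1 - k) * (q - 1)) ^ 2 := exp_mul_le_sq hk' (by linarith) _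
    _ = k + (1 - k) * (q ^ 2 - k * (1 - q) ^ 2) := by ring
    _ ≤ k + (1 - k) * (ε * (1 + k * ε) - k * ε ^ 2) := by gcongr
    _ = k + (1 - k) * ε := by ring

theorem exp_sub_mul_add_exp_lt {x k : ℝ} (hx : log 2 ≤ x) (hk : 0 < k) (hk1 : k ≤ 1) :
    exp (2 * x - k * (logTwoCosh x - x)) +
        exp (-((1 - k) * (2 * x - k * (logTwoCosh x - x)))) <
      exp (2 * x) + exp (-(2 * x)) := by
  have hfirst := exp_sub_mul_le hk.le hk1 x
  have hsecond := exp_neg_one_sub_mul_le hx hk.le hk1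
  have hε := exp_pos (-(2 * x))
  have hfrac : k * (1 - exp (-(2 * x))) < k / (1 + exp (-(2 * x))) := by
    rw [lt_div_iff₀ (by positivity)]
    nlinarith [mul_pos hk (pow_pos hε 2)]
  linarith

theorem exp_mul_sqSlope_add_exp_lt_of_le {x y : ℝ} (hx : log 2 ≤ x) (hxy : x ≤ y) :
    exp (x * sqSlope x y * (x + y)) + exp (x * sqSlope x y * (x - y)) <
      exp (2 * x) + exp (-(2 * x)) := by
  have hx0 : 0 < x := (log_pos one_lt_two).trans_le hx
  have hx2 : 1 / 2 ≤ x := by linarith [log_two_gt_d9]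
  have hy0 : 0 < y := hx0.trans_le hxy
  set k := 2 * x / (x + y) with hk
  have hk0 : 0 < k := by positivity
  have hk1 : k ≤ 1 := div_le_one_of_le₀ (by linarith) (by positivity)
  have hle := mul_sqSlope_mul_add_le hx2 hxy
  have hw := sqSlope_pos hx0 hy0.le
  have hneg : x * sqSlope x y * (x - y) = -((1 - k) * (x * sqSlope x y * (x + y))) := by
    rw [hk]
    field_simp
    ring
  have hP : 0 ≤ x * sqSlope x y * (x + y) := by positivity
  rw [hneg]
  exact (monotoneOn_exp_add_exp_neg_mul (sub_nonneg.2 hk1) (by linarith)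
    hP (hP.trans hle) hle).trans_lt (exp_sub_mul_add_exp_lt hx hk0 hk1)

theorem exp_mul_one_sub_exp_le {x y : ℝ} (hy : 0 ≤ y) (hyx : y < x) :
    exp (-(2 * y)) * (1 - exp (-(2 * x))) ≤
      (1 + exp (-(2 * x))) * (exp (x - x * sqSlope x y * (x + y) / 2) - 1) := by
  have hx : 0 < x := hy.trans_lt hyx
  -- With `ε = exp (-(2 * x))` and `η = exp (-(2 * y))`, the logarithms of `(1 + η) / (1 + ε)` and
  -- `ε / η` are `τ * D` and `τ * -(2 * x)`; the chord bounds for both together eliminate `τ`.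
  set τ := (x - y) / x with hτ
  have hτ0 : 0 < τ := div_pos (sub_pos.2 hyx) hx
  have hτ1 : τ ≤ 1 := div_le_one_of_le₀ (by linarith) hx.le
  set D := x - x * sqSlope x y * (x + y) / 2 with hD
  have hτD : τ * D = (logTwoCosh y - y) - (logTwoCosh x - x) := by
    rw [hτ, hD]
    field_simp
    linear_combination sq_sub_sq_mul_sqSlope hx.le hy
  have hupper := exp_mul_le_one_add hτ0.le hτ1 D
  rw [hτD, exp_sub, exp_logTwoCosh_sub_self, exp_logTwoCosh_sub_self,
    div_le_iff₀ (by positivity)] at hupper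
  have hlower : exp (-(2 * x)) ≤
      exp (-(2 * y)) * (1 + τ * (exp (-(2 * x)) - 1)) := calc
    exp (-(2 * x)) = exp (-(2 * y)) * exp (τ * -(2 * x)) := by
      rw [← exp_add, hτ]
      field_simp
      ring_nf
    _ ≤ exp (-(2 * y)) * (1 + τ * (exp (-(2 * x)) - 1)) := by
      gcongr
      exact exp_mul_le_one_add hτ0.le hτ1 _
  refine le_of_mul_le_mul_left ?_ hτ0
  linear_combination hupper + hlower

theorem exp_mul_sqSlope_mul_add_le {x y : ℝ} (hy : 0 ≤ y) (hyx : y < x) :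
    exp (x * sqSlope x y * (x + y)) ≤
      exp (2 * x) * ((1 + exp (-(2 * x))) /
        (1 + exp (-(2 * x)) + exp (-(2 * y)) * (1 - exp (-(2 * x))))) ^ 2 := by
  have hratio := exp_mul_one_sub_exp_le hy hyx
  set D := x - x * sqSlope x y * (x + y) / 2 with hD
  have hP : exp (x * sqSlope x y * (x + y)) = exp (2 * x) * (1 / exp D) ^ 2 := by
    rw [one_div, ← exp_neg, ← exp_nat_mul, ← exp_add, hD]
    ring_nf
  have hε : 0 ≤ 1 - exp (-(2 * x)) := sub_nonneg.2 (exp_le_one_iff.2 (by linarith))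
  have hbase : 1 / exp D ≤ (1 + exp (-(2 * x))) /
      (1 + exp (-(2 * x)) + exp (-(2 * y)) * (1 - exp (-(2 * x)))) := by
    rw [div_le_div_iff₀ (exp_pos D) (by positivity)]
    linarith
  rw [hP]
  exact mul_le_mul_of_nonneg_left (pow_le_pow_left₀ (by positivity) hbase 2) (exp_pos _).le

theorem logTwoCosh_sub_self_le {x y : ℝ} (hyx : y ≤ x) : logTwoCosh x - x ≤ logTwoCosh y - y := by
  rw [← exp_le_exp, exp_logTwoCosh_sub_self, exp_logTwoCosh_sub_self]
  gcongr

theorem exp_mul_sqSlope_mul_sub_le {x y : ℝ} (hy : 0 ≤ y) (hyx : y < x) :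
    exp (x * sqSlope x y * (x - y)) ≤
      exp (2 * x) * (exp (-(2 * y)) * (1 + exp (-(2 * x))) / (1 + exp (-(2 * y)))) := by
  have hx : 0 < x := hy.trans_lt hyx
  have hslope : (x + y) * sqSlope x y ≤ 2 := by
    refine le_of_mul_le_mul_left ?_ (sub_pos.2 hyx)
    linarith [sq_sub_sq_mul_sqSlope hx.le hy, logTwoCosh_sub_self_le hyx.le]
  have hle : x * sqSlope x y * (x - y) ≤ (x - y) + (logTwoCosh x - logTwoCosh y) := by
    have : (x - y) * sqSlope x y ≤ 2 := by nlinarith [sqSlope_pos hx hy]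
    nlinarith [sq_sub_sq_mul_sqSlope hx.le hy]
  refine (exp_le_exp.2 hle).trans_eq ?_
  rw [← exp_logTwoCosh_sub_self, ← exp_logTwoCosh_sub_self, ← exp_add, ← exp_sub, ← exp_add]
  ring_nf

theorem div_sq_add_div_lt_one_add_sq {ε η : ℝ} (hε : 0 < ε) (hε4 : ε ≤ 1 / 4) (hη : 0 < η)
    (hη1 : η ≤ 1) :
    ((1 + ε) / (1 + ε + η * (1 - ε))) ^ 2 + η * (1 + ε) / (1 + η) < 1 + ε ^ 2 := by
  have hε1 : 0 < 1 - ε := by linarith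
  have hlin : 0 ≤ 1 - 4 * ε + 2 * ε ^ 2 - ε ^ 3 := by nlinarith
  have hquad : 0 ≤ 1 - 2 * ε - ε ^ 2 - η * ε * (1 - ε) := by nlinarith [mul_pos hε hε1]
  have hexp : (1 + ε + η * (1 - ε)) ^ 2 * (1 + ε ^ 2 - η * ε * (1 - ε)) -
      (1 + ε) ^ 2 * (1 + η) = (1 + ε) ^ 2 * ε ^ 2 + η * (1 + ε) * (1 - 4 * ε + 2 * ε ^ 2 - ε ^ 3) +
        η ^ 2 * (1 - ε) ^ 2 * (1 - 2 * ε - ε ^ 2 - η * ε * (1 - ε)) := by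
    ring
  have hpos : (1 + ε) ^ 2 * (1 + η) <
      (1 + ε + η * (1 - ε)) ^ 2 * (1 + ε ^ 2 - η * ε * (1 - ε)) := by
    rw [← sub_pos, hexp]
    positivity
  rw [div_pow, div_add_div _ _ (by positivity) (by positivity), div_lt_iff₀ (by positivity)]
  linear_combination hpos

theorem exp_mul_sqSlope_add_exp_lt_of_lt {x y : ℝ} (hx : log 2 ≤ x) (hy : 0 ≤ y) (hyx : y < x) :
    exp (x * sqSlope x y * (x + y)) + exp (x * sqSlope x y * (x - y)) <
      exp (2 * x) + exp (-(2 * x)) := by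
  have hpoly := div_sq_add_div_lt_one_add_sq (exp_pos (-(2 * x)))
    (exp_neg_two_mul_le_of_log_two_le hx) (exp_pos (-(2 * y))) (exp_le_one_iff.2 (by linarith))
  calc exp (x * sqSlope x y * (x + y)) + exp (x * sqSlope x y * (x - y))
      ≤ _ := add_le_add (exp_mul_sqSlope_mul_add_le hy hyx) (exp_mul_sqSlope_mul_sub_le hy hyx)
    _ < exp (2 * x) * (1 + exp (-(2 * x)) ^ 2) := by
      rw [← mul_add]
      gcongr
    _ = exp (2 * x) + exp (-(2 * x)) := by
      rw [← exp_nat_mul, mul_add, mul_one, ← exp_add]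
      ring_nf

theorem exp_mul_sqSlope_add_exp_lt {x y : ℝ} (hx : 0 < x) (hy : 0 ≤ y) :
    exp (x * sqSlope x y * (x + y)) + exp (x * sqSlope x y * (x - y)) <
      exp (2 * x) + exp (-(2 * x)) := by
  rcases le_total x (log 2) with hx2 | hx2
  · exact exp_mul_sqSlope_add_exp_lt_of_le_log_two hx hx2 hy
  · rcases le_or_gt x y with hxy | hyx
    · exact exp_mul_sqSlope_add_exp_lt_of_le hx2 hxy
    · exact exp_mul_sqSlope_add_exp_lt_of_lt hx2 hy hyx

theorem exp_rpow_add_exp_rpow (r m x : ℝ) :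
    exp (m + x) ^ r + exp (m - x) ^ r = exp (r * m + logTwoCosh (r * x)) := by
  rw [exp_add (r * m), exp_logTwoCosh, mul_add, ← exp_add, ← exp_add, ← exp_mul, ← exp_mul]
  ring_nf

theorem genInvHarmonicMean_exp_of_ne {r : ℝ} (hr : r ≠ 1) (m x : ℝ) :
    genInvHarmonicMean r (exp (m - x)) (exp (m + x)) =
      exp (m + (logTwoCosh (r * x) - logTwoCosh x) / (r - 1)) := by
  have hr1 : r - 1 ≠ 0 := sub_ne_zero.2 hr
  have hsum := exp_rpow_add_exp_rpow 1 m x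
  simp only [rpow_one, one_mul] at hsum
  rw [genInvHarmonicMean, if_neg hr, exp_rpow_add_exp_rpow, hsum, ← exp_sub, ← exp_mul]
  congr 1
  field_simp
  ring

theorem genInvHarmonicMean_one_exp (m x : ℝ) :
    genInvHarmonicMean 1 (exp (m - x)) (exp (m + x)) = exp (m + x * tanh x) := by
  have hlog : ((m + x) * exp (m + x) + (m - x) * exp (m - x)) / (exp (m + x) + exp (m - x)) =
      m + x * tanh x := by
    rw [tanh_eq, exp_add, sub_eq_add_neg, exp_add]
    field_simp
    ring
  rw [genInvHarmonicMean, if_pos rfl, ← exp_mul, ← exp_mul, ← exp_add, ← exp_mul, ← hlog]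
  ring_nf

theorem genInvHarmonicMean_exp_sq {x : ℝ} (hx : 0 < x) (r m : ℝ) :
    genInvHarmonicMean r (exp (m - x)) (exp (m + x)) ^ 2 =
      exp (2 * m) * exp (x * sqSlope x (|r| * x) * (x + r * x)) := by
  rw [← exp_add]
  rcases eq_or_ne r 1 with rfl | h
  · rw [genInvHarmonicMean_one_exp, ← exp_nat_mul, abs_one, one_mul, sqSlope_self]
    field_simp
    ring_nf
  · have hr1 : r - 1 ≠ 0 := sub_ne_zero.2 h
    have hE := sq_sub_sq_mul_sqSlope hx.le (mul_nonneg (abs_nonneg r) hx.le)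
    have habs : logTwoCosh (|r| * x) = logTwoCosh (r * x) := by
      rw [← abs_of_pos hx, ← abs_mul, logTwoCosh_abs, abs_of_pos hx]
    rw [habs, mul_pow, sq_abs] at hE
    rw [genInvHarmonicMean_exp_of_ne h, ← exp_nat_mul]
    generalize sqSlope x (|r| * x) = w at hE ⊢
    congr 1
    push_cast
    field_simp
    linear_combination -hE

theorem exists_eq_exp_sub_exp_add {a b : ℝ} (ha : 0 < a) (hab : a < b) :
    ∃ m x, 0 < x ∧ a = exp (m - x) ∧ b = exp (m + x) := by
  refine ⟨(log a + log b) / 2, (log b - log a) / 2, by linarith [log_lt_log ha hab], ?_, ?_⟩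
  · rw [← exp_log ha, log_exp]
    ring_nf
  · rw [← exp_log (ha.trans hab), log_exp]
    ring_nf

theorem theorem4p2 (r a b : ℝ) (hr : 0 ≤ r) (ha : 0 < a) (hab : a < b) :
    genInvHarmonicMean r a b ^ 2 + genInvHarmonicMean (-r) a b ^ 2 < a ^ 2 + b ^ 2 := by
  obtain ⟨m, x, hx, rfl, rfl⟩ := exists_eq_exp_sub_exp_add ha hab
  have hsq : exp (m - x) ^ 2 + exp (m + x) ^ 2 =
      exp (2 * m) * (exp (2 * x) + exp (-(2 * x))) := by
    rw [← exp_nat_mul, ← exp_nat_mul, mul_add (exp _), ← exp_add, ← exp_add]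
    ring_nf
  rw [genInvHarmonicMean_exp_sq hx, genInvHarmonicMean_exp_sq hx, abs_neg, abs_of_nonneg hr, hsq,
    ← mul_add, neg_mul, ← sub_eq_add_neg]
  exact mul_lt_mul_of_pos_left (exp_mul_sqSlope_add_exp_lt hx (mul_nonneg hr hx.le)) (exp_pos _)
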